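/- All Hilbert spaces are complex, operators are bounded and linear, $\{N\}'$ denotes the commutant of $N$, $R(A)$ the range of $A$, and $|A|=(A^*A)^{1/2}$. An inclusion $H\subseteq K$ of Hilbert spaces is an isometric embedding; for $A\in B(H_2,H_1)$, $B\in B(K_2,K_1)$ with $H_j\subseteq K_j$, $A\subseteq B$ means that $Ah=Bh$ for all $h\in H_2$. A polar decomposition $A=W|A|$ means that $W$ is a partial isometry with $\ker W=\ker A$. For nonzero Hilbert spaces $H_1,H_2$ and a class $\mathscr X$ of operators, write $\begin{bmatrix} V&E\\0&X\end{bmatrix}\in\mathscr X_{H_1,H_2}$ if $V\in B(H_1)$, $E\in B(H_2,H_1)$, $X\in B(H_2)$ satisfy $V^*V=I$, $V^*E=0$, $XE^*E=E^*EX$ and $X\in\mathscr X$; $\mathscr S$ and $\mathscr N$ are the classes of subnormal and of normal operators. For operators on $H_1\oplus H_2$ and $K_1\oplus K_2$, $[A_{ij}]\preceq[\tilde A_{ij}]$ (entrywise extension) means $H_j\subseteq K_j$ and $A_{ij}\subseteq\tilde A_{ij}$ for $i,j=1,2$. A normal operator $N\in B(K)$ with $S\subseteq N$, $S\in B(H)$,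 is a minimal normal extension of $S$ if $K$ is the only closed subspace of $K$ containing $H$ and reducing $N$; the lift of $A\in B(H)$ relative to $\{N\}'$ is then the (unique) operator $B\in\{N\}'\cap\{P\}'$ with $A\subseteq B$, where $P$ is the orthogonal projection of $K$ onto $H$. **Theorem 1.7.** Suppose that $T=\begin{bmatrix} V&E\\0&S\end{bmatrix}\in\mathscr S_{H_1,H_2}$, $E$ is injective and $N\in B(K_2)$ is a minimal normal extension of $S$. Let $E=W|E|$ be the polar decomposition of $E$. Then $|E|$ is injective, $W$ is an isometry and the following hold: (i) if $\begin{bmatrix}\tilde V&\tilde E\\0&N\end{bmatrix}\in\mathscr N_{K_1,K_2}$ is an entrywise extension of $T$ such that $|E|\subseteq|\tilde E|$, and $\tilde E=U|\tilde E|$ is the polar decomposition of $\tilde E$, then $\tilde E$ is injective, $|\tilde E|$ is the lift of $|E|$ relative to $\{N\}'$, and $U\in B(K_2,K_1)$ is an isometry such that $W\subseteq U$ and $R(\tilde V)\perp R(U)$; (ii) if $\tilde V\in B(K_1)$ and $U\in B(K_2,K_1)$ are isometries such that $V\subseteq\tilde V$, $W\subseteq U$ and $R(\tilde V)\perp R(U)$,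 and $B\in B(K_2)$ is the lift of $|E|$ relative to $\{N\}'$, then, with $\tilde E:=UB$, $\begin{bmatrix}\tilde V&\tilde E\\0&N\end{bmatrix}\in\mathscr N_{K_1,K_2}$, $T\preceq\begin{bmatrix}\tilde V&\tilde E\\0&N\end{bmatrix}$, $|E|\subseteq|\tilde E|$, and $\tilde E=UB$ is the polar decomposition of $\tilde E$ (in particular $B=|\tilde E|$). -/

import Mathlib

open scoped InnerProductSpace

namespace BrownianLift

noncomputable section

universe u v w z

section Blocks

variable {H₁ : Type u} {H₂ : Type v}
  [NormedAddCommGroup H₁] [InnerProductSpace ℂ H₁]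
  [NormedAddCommGroup H₂] [InnerProductSpace ℂ H₂]

/-- The operator on the Hilbert space direct sum `H₁ ⊕ H₂` (the `ℓ²`-sum) given by the block matrix
`[[A₁₁, A₁₂], [A₂₁, A₂₂]]`, i.e. `(x, y) ↦ (A₁₁ x + A₁₂ y, A₂₁ x + A₂₂ y)`. -/
def blockOp (A₁₁ : H₁ →L[ℂ] H₁) (A₁₂ : H₂ →L[ℂ] H₁) (A₂₁ : H₁ →L[ℂ] H₂) (A₂₂ : H₂ →L[ℂ] H₂) :
    WithLp 2 (H₁ × H₂) →L[ℂ] WithLp 2 (H₁ × H₂) :=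
  ((WithLp.prodContinuousLinearEquiv 2 ℂ H₁ H₂).symm : H₁ × H₂ →L[ℂ] WithLp 2 (H₁ × H₂)) ∘L
    ((A₁₁.coprod A₁₂).prod (A₂₁.coprod A₂₂)) ∘L
      (WithLp.prodContinuousLinearEquiv 2 ℂ H₁ H₂ : WithLp 2 (H₁ × H₂) →L[ℂ] H₁ × H₂)

/-- Embedding of the first summand into `H₁ ⊕ H₂`. -/
def inc₁ : H₁ →L[ℂ] WithLp 2 (H₁ × H₂) :=
  ((WithLp.prodContinuousLinearEquiv 2 ℂ H₁ H₂).symm : H₁ × H₂ →L[ℂ] WithLp 2 (H₁ × H₂)) ∘L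
    ContinuousLinearMap.inl ℂ H₁ H₂

/-- Embedding of the second summand into `H₁ ⊕ H₂`. -/
def inc₂ : H₂ →L[ℂ] WithLp 2 (H₁ × H₂) :=
  ((WithLp.prodContinuousLinearEquiv 2 ℂ H₁ H₂).symm : H₁ × H₂ →L[ℂ] WithLp 2 (H₁ × H₂)) ∘L
    ContinuousLinearMap.inr ℂ H₁ H₂

/-- First coordinate on `H₁ ⊕ H₂`. -/
def pr₁ : WithLp 2 (H₁ × H₂) →L[ℂ] H₁ :=
  ContinuousLinearMap.fst ℂ H₁ H₂ ∘L
    (WithLp.prodContinuousLinearEquiv 2 ℂ H₁ H₂ : WithLp 2 (H₁ × H₂) →L[ℂ] H₁ × H₂)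

/-- Second coordinate on `H₁ ⊕ H₂`. -/
def pr₂ : WithLp 2 (H₁ × H₂) →L[ℂ] H₂ :=
  ContinuousLinearMap.snd ℂ H₁ H₂ ∘L
    (WithLp.prodContinuousLinearEquiv 2 ℂ H₁ H₂ : WithLp 2 (H₁ × H₂) →L[ℂ] H₁ × H₂)

/-- The `(1,1)` entry of an operator on `H₁ ⊕ H₂`. -/
def entry₁₁ (T : WithLp 2 (H₁ × H₂) →L[ℂ] WithLp 2 (H₁ × H₂)) : H₁ →L[ℂ] H₁ := pr₁ ∘L T ∘L inc₁

/-- The `(1,2)` entry of an operator on `H₁ ⊕ H₂`. -/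
def entry₁₂ (T : WithLp 2 (H₁ × H₂) →L[ℂ] WithLp 2 (H₁ × H₂)) : H₂ →L[ℂ] H₁ := pr₁ ∘L T ∘L inc₂

/-- The `(2,1)` entry of an operator on `H₁ ⊕ H₂`. -/
def entry₂₁ (T : WithLp 2 (H₁ × H₂) →L[ℂ] WithLp 2 (H₁ × H₂)) : H₁ →L[ℂ] H₂ := pr₂ ∘L T ∘L inc₁

/-- The `(2,2)` entry of an operator on `H₁ ⊕ H₂`. -/
def entry₂₂ (T : WithLp 2 (H₁ × H₂) →L[ℂ] WithLp 2 (H₁ × H₂)) : H₂ →L[ℂ] H₂ := pr₂ ∘L T ∘L inc₂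

variable (A₁₁ : H₁ →L[ℂ] H₁) (A₁₂ : H₂ →L[ℂ] H₁) (A₂₁ : H₁ →L[ℂ] H₂) (A₂₂ : H₂ →L[ℂ] H₂)

@[simp] theorem entry₁₁_blockOp : entry₁₁ (blockOp A₁₁ A₁₂ A₂₁ A₂₂) = A₁₁ := by
  ext x; simp [entry₁₁, blockOp, pr₁, inc₁]

@[simp] theorem entry₁₂_blockOp : entry₁₂ (blockOp A₁₁ A₁₂ A₂₁ A₂₂) = A₁₂ := by
  ext x; simp [entry₁₂, blockOp, pr₁, inc₂]

@[simp] theorem entry₂₁_blockOp : entry₂₁ (blockOp A₁₁ A₁₂ A₂₁ A₂₂) = A₂₁ := by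
  ext x; simp [entry₂₁, blockOp, pr₂, inc₁]

@[simp] theorem entry₂₂_blockOp : entry₂₂ (blockOp A₁₁ A₁₂ A₂₁ A₂₂) = A₂₂ := by
  ext x; simp [entry₂₂, blockOp, pr₂, inc₂]

end Blocks

section Extensions

variable {H₁ : Type u} {H₂ : Type v} {K₁ : Type w} {K₂ : Type z}
  [NormedAddCommGroup H₁] [InnerProductSpace ℂ H₁]
  [NormedAddCommGroup H₂] [InnerProductSpace ℂ H₂]
  [NormedAddCommGroup K₁] [InnerProductSpace ℂ K₁]
  [NormedAddCommGroup K₂] [InnerProductSpace ℂ K₂]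

/-- `A ⊆ B` for `A : H₂ → H₁` and `B : K₂ → K₁`, where `H₂ ⊆ K₂` and `H₁ ⊆ K₁` through the
isometric embeddings `ι₂` and `ι₁`: `B h = A h` for all `h ∈ H₂`. -/
def Extends (ι₂ : H₂ →ₗᵢ[ℂ] K₂) (ι₁ : H₁ →ₗᵢ[ℂ] K₁) (A : H₂ →L[ℂ] H₁) (B : K₂ →L[ℂ] K₁) : Prop :=
  ∀ h : H₂, B (ι₂ h) = ι₁ (A h)

/-- The operator `T'` on `K₁ ⊕ K₂` is an entrywise extension of the operator `T` on `H₁ ⊕ H₂`,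
where `H₁ ⊆ K₁` and `H₂ ⊆ K₂` through `ι₁` and `ι₂`. -/
structure EntrywiseExtends (ι₁ : H₁ →ₗᵢ[ℂ] K₁) (ι₂ : H₂ →ₗᵢ[ℂ] K₂)
    (T : WithLp 2 (H₁ × H₂) →L[ℂ] WithLp 2 (H₁ × H₂))
    (T' : WithLp 2 (K₁ × K₂) →L[ℂ] WithLp 2 (K₁ × K₂)) : Prop where
  ext₁₁ : Extends ι₁ ι₁ (entry₁₁ T) (entry₁₁ T')
  ext₁₂ : Extends ι₂ ι₁ (entry₁₂ T) (entry₁₂ T')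
  ext₂₁ : Extends ι₁ ι₂ (entry₂₁ T) (entry₂₁ T')
  ext₂₂ : Extends ι₂ ι₂ (entry₂₂ T) (entry₂₂ T')

end Extensions

section Operators

variable {H : Type u} {K : Type v}
  [NormedAddCommGroup H] [InnerProductSpace ℂ H] [CompleteSpace H]
  [NormedAddCommGroup K] [InnerProductSpace ℂ K] [CompleteSpace K]

/-- The modulus `|A| = (A* A)^{1/2}` of a bounded operator `A : H → K`. -/
def modulus (A : H →L[ℂ] K) : H →L[ℂ] H :=
  CFC.sqrt (ContinuousLinearMap.adjoint A ∘L A)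

/-- A partial isometry: an operator which is isometric on the orthogonal complement of its
kernel. -/
def IsPartialIsometry (W : H →L[ℂ] K) : Prop :=
  ∀ x ∈ (LinearMap.ker W.toLinearMap)ᗮ, ‖W x‖ = ‖x‖

/-- `A = W P` is the polar decomposition of `A`: `P = |A|` and `W` is a partial isometry with the
same kernel as `A`. -/
structure IsPolarDecomposition (A : H →L[ℂ] K) (W : H →L[ℂ] K) (P : H →L[ℂ] H) : Prop where
  factor : A = W ∘L P
  eq_modulus : P = modulus A
  partialIsometry : IsPartialIsometry W
  ker_eq : LinearMap.ker W.toLinearMap = LinearMap.ker A.toLinearMap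

/-- `N` is a normal extension of `S`, where `H ⊆ K` through `ι`. -/
structure IsNormalExtension (ι : H →ₗᵢ[ℂ] K) (S : H →L[ℂ] H) (N : K →L[ℂ] K) : Prop where
  normal : IsStarNormal N
  extends_op : Extends ι ι S N

/-- `N` is a minimal normal extension of `S`: the only closed subspace of `K` that contains `H` and
reduces `N` (is invariant for `N` and `N*`) is `K`. -/
structure IsMinimalNormalExtension (ι : H →ₗᵢ[ℂ] K) (S : H →L[ℂ] H) (N : K →L[ℂ] K) : Prop
    extends IsNormalExtension ι S N where
  minimal : ∀ M : Submodule ℂ K, IsClosed (M : Set K) → (∀ h : H, ι h ∈ M) →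
    (∀ x ∈ M, N x ∈ M) → (∀ x ∈ M, ContinuousLinearMap.adjoint N x ∈ M) → M = ⊤

/-- The orthogonal projection of `K` onto (the image under `ι` of) `H`. -/
def embProj (ι : H →ₗᵢ[ℂ] K) : K →L[ℂ] K :=
  ι.toContinuousLinearMap ∘L ContinuousLinearMap.adjoint ι.toContinuousLinearMap

/-- `B` is the lift of `A` relative to `{N}'`: `B ∈ {N}' ∩ {P}'` and `A ⊆ B`, where `P` is the
orthogonal projection of `K` onto `H`. (When `N` is a minimal normal extension, there is at most
one such `B`.) -/
structure IsLift (ι : H →ₗᵢ[ℂ] K) (N : K →L[ℂ] K) (A : H →L[ℂ] H) (B : K →L[ℂ] K) : Prop where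
  mem_commutant : B ∈ Set.centralizer {N}
  mem_commutant_proj : B ∈ Set.centralizer {embProj ι}
  extends_op : Extends ι ι A B

/-- The class of normal operators. -/
def NormalClass (X : H →L[ℂ] H) : Prop := IsStarNormal X

/-- The class of subnormal operators: those having a normal extension on some Hilbert space. The
extension space may be taken in the universe of `H`, because a minimal normal extension acts on a
space of the same Hilbert dimension as `H`. -/
def SubnormalClass (X : H →L[ℂ] H) : Prop :=
  ∃ (L : Type u) (_ : NormedAddCommGroup L) (_ : InnerProductSpace ℂ L) (_ : CompleteSpace L)
    (ι : H →ₗᵢ[ℂ] L) (N : L →L[ℂ] L), IsNormalExtension ι X N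

end Operators

section Brownian

variable {H₁ : Type u} {H₂ : Type v}
  [NormedAddCommGroup H₁] [InnerProductSpace ℂ H₁] [CompleteSpace H₁]
  [NormedAddCommGroup H₂] [InnerProductSpace ℂ H₂] [CompleteSpace H₂]

/-- `T` is a Brownian-type operator of class `𝒳` with respect to the decomposition `H₁ ⊕ H₂`: the
spaces are nonzero, `T = [[V, E], [0, X]]`, `V` is an isometry, `V* E = 0`, `X E* E = E* E X`, and
`X` is in the class `𝒳`. -/
structure IsBrownianType (𝒳 : (H₂ →L[ℂ] H₂) → Prop)
    (T : WithLp 2 (H₁ × H₂) →L[ℂ] WithLp 2 (H₁ × H₂)) : Prop where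
  nontrivial₁ : Nontrivial H₁
  nontrivial₂ : Nontrivial H₂
  lower_eq_zero : entry₂₁ T = 0
  isometry : Isometry (entry₁₁ T)
  orthogonal : ContinuousLinearMap.adjoint (entry₁₁ T) ∘L entry₁₂ T = 0
  commute : entry₂₂ T ∘L (ContinuousLinearMap.adjoint (entry₁₂ T) ∘L entry₁₂ T) =
    (ContinuousLinearMap.adjoint (entry₁₂ T) ∘L entry₁₂ T) ∘L entry₂₂ T
  mem_class : 𝒳 (entry₂₂ T)

end Brownian

end

end BrownianLift

universe u₁ u₂ u₃ u₄

namespace BrownianLift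

open ContinuousLinearMap

/-! ### Moduli, kernels and dense ranges. -/

section Modulus

variable {H K : Type*}
  [NormedAddCommGroup H] [InnerProductSpace ℂ H] [CompleteSpace H]
  [NormedAddCommGroup K] [InnerProductSpace ℂ K] [CompleteSpace K]

/-! Everything is governed by the modulus in the second summand. By Fuglede's theorem, kernels of
operators in `{N}'` reduce `N`, so minimality makes such operators determined by their values on
`H₂` (`eq_of_commute`), and self-adjoint ones extending an injective operator injective
(`injective_of_commute`). In (i), `|E'|` commutes with `E'* E'`'s commutant, hence with `N`; being
self-adjoint and extending `|E|`, it is reduced by `H₂`, so it is the lift. The claims on `U` hold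
on the dense ranges of `|E|` and `|E'|` and pass to closures. In (ii) the point is that the lift `B`
is positive (`IsLift.eq_modulus`): `B` and `|B|` both lie in `{N}'` and agree on `H₂`. Then `|UB| =
|B| = B`, and the required identities follow. -/

theorem modulus_nonneg (A : H →L[ℂ] K) : 0 ≤ modulus A :=
  CFC.sqrt_nonneg _

theorem isSelfAdjoint_modulus (A : H →L[ℂ] K) : IsSelfAdjoint (modulus A) :=
  (modulus_nonneg A).isSelfAdjoint

theorem adjoint_comp_self_nonneg (A : H →L[ℂ] K) : 0 ≤ adjoint A ∘L A :=
  (nonneg_iff_isPositive _).2 (isPositive_adjoint_comp_self A)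

theorem modulus_mul_self (A : H →L[ℂ] K) : modulus A * modulus A = adjoint A ∘L A :=
  CFC.sqrt_mul_sqrt_self _ (adjoint_comp_self_nonneg A)

theorem modulus_apply_modulus_apply (A : H →L[ℂ] K) (x : H) :
    modulus A (modulus A x) = adjoint A (A x) :=
  DFunLike.congr_fun (modulus_mul_self A) x

theorem ker_modulus (A : H →L[ℂ] K) : (modulus A).ker = A.ker := by
  have h := (modulus A).ker_adjoint_comp_self
  rw [(isSelfAdjoint_modulus A).adjoint_eq] at h
  rw [← h, ← A.ker_adjoint_comp_self, ← modulus_mul_self]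
  rfl

theorem modulus_injective_iff (A : H →L[ℂ] K) :
    Function.Injective (modulus A) ↔ Function.Injective A := by
  have h := ker_modulus A
  constructor <;> intro hA
  · have h' : (modulus A).ker = ⊥ := LinearMap.ker_eq_bot.2 hA
    exact LinearMap.ker_eq_bot.1 (h ▸ h')
  · have h' : A.ker = ⊥ := LinearMap.ker_eq_bot.2 hA
    exact LinearMap.ker_eq_bot.1 (h.trans h')

/-- The square root is a continuous function of `A* A`, and functional calculus preserves
commutation. -/
theorem commute_modulus {A : H →L[ℂ] K} {X : H →L[ℂ] H}
    (h : Commute (adjoint A ∘L A) X) : Commute (modulus A) X :=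
  h.cfcₙ_nnreal _

theorem modulus_comp_of_isometry {L : Type*} [NormedAddCommGroup L] [InnerProductSpace ℂ L]
    [CompleteSpace L] {U : K →L[ℂ] L} (hU : Isometry U) (B : H →L[ℂ] K) :
    modulus (U ∘L B) = modulus B := by
  have h : adjoint U ∘L U = 1 := (isometry_iff_adjoint_comp_self U).1 hU
  unfold modulus
  rw [adjoint_comp, comp_assoc, ← comp_assoc _ U B, h]
  rfl

/-- The orthogonal complement of the range is the kernel of the adjoint. This allows an injective
modulus to be cancelled on the right. -/
theorem denseRange_of_isSelfAdjoint {A : H →L[ℂ] H} (hA : IsSelfAdjoint A)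
    (hinj : Function.Injective A) : DenseRange A := by
  have h : A.rangeᗮ = ⊥ := by
    rw [A.orthogonal_range, hA.adjoint_eq]
    exact LinearMap.ker_eq_bot.2 hinj
  have := (Submodule.topologicalClosure_eq_top_iff (K := A.range)).2 h
  exact (Submodule.dense_iff_topologicalClosure_eq_top (s := A.range)).2 this

theorem IsPolarDecomposition.isometry {A W : H →L[ℂ] K} {P : H →L[ℂ] H}
    (h : IsPolarDecomposition A W P) (hA : Function.Injective A) : Isometry W := by
  have hker : W.ker = ⊥ := h.ker_eq.trans (LinearMap.ker_eq_bot.2 hA)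
  refine AddMonoidHomClass.isometry_of_norm W fun x => h.partialIsometry x ?_
  change x ∈ W.kerᗮ
  simp [hker]

end Modulus

/-- Two operators in the commutant of a minimal normal extension that agree on `H` are equal. -/
theorem IsMinimalNormalExtension.eq_of_commute {H K : Type*}
    [NormedAddCommGroup H] [InnerProductSpace ℂ H]
    [NormedAddCommGroup K] [InnerProductSpace ℂ K] [CompleteSpace K]
    {ι : H →ₗᵢ[ℂ] K} {S : H →L[ℂ] H} {N : K →L[ℂ] K} (hN : IsMinimalNormalExtension ι S N)
    {B C : K →L[ℂ] K} (hB : Commute B N) (hC : Commute C N)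
    (h : ∀ x, B (ι x) = C (ι x)) : B = C := by
  have hD : Commute (B - C) N := hB.sub_left hC
  -- Fuglede's theorem; hence the kernel of `B - C` reduces `N`, and it contains `H`.
  have hD' : Commute (B - C) (star N) := hN.normal.commute_star_right hD
  have key : (B - C).ker = ⊤ := by
    refine hN.minimal _ (B - C).isClosed_ker (fun x => ?_) (fun x hx => ?_) (fun x hx => ?_)
    · change (B - C) (ι x) = 0
      simp [h]
    · have hx : (B - C) x = 0 := hx
      change ((B - C) * N) x = 0
      rw [hD.eq, mul_apply_eq_comp, hx, map_zero]
    · have hx : (B - C) x = 0 := hx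
      change ((B - C) * star N) x = 0
      rw [hD'.eq, mul_apply_eq_comp, hx, map_zero]
  ext x
  have hx : x ∈ (B - C).ker := key ▸ Submodule.mem_top
  exact sub_eq_zero.1 hx

/-! ### Lifts and reduction by the embedded subspace. -/

section Lift

variable {H K : Type*}
  [NormedAddCommGroup H] [InnerProductSpace ℂ H] [CompleteSpace H]
  [NormedAddCommGroup K] [InnerProductSpace ℂ K] [CompleteSpace K]
  {ι : H →ₗᵢ[ℂ] K} {S : H →L[ℂ] H} {N : K →L[ℂ] K}

theorem adjoint_embedding_apply (ι : H →ₗᵢ[ℂ] K) (h : H) :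
    adjoint ι.toContinuousLinearMap (ι h) = h :=
  DFunLike.congr_fun
    ((isometry_iff_adjoint_comp_self ι.toContinuousLinearMap).1 ι.isometry) h

theorem embProj_apply (ι : H →ₗᵢ[ℂ] K) (x : K) :
    embProj ι x = ι (adjoint ι.toContinuousLinearMap x) := rfl

theorem isSelfAdjoint_embProj (ι : H →ₗᵢ[ℂ] K) : IsSelfAdjoint (embProj ι) := by
  rw [isSelfAdjoint_iff']
  simp [embProj, adjoint_comp]

/-- A self-adjoint operator leaving `H` invariant commutes with the projection onto `H`. -/
theorem Extends.commute_embProj {A : H →L[ℂ] H} {B : K →L[ℂ] K} (h : Extends ι ι A B)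
    (hB : IsSelfAdjoint B) : Commute B (embProj ι) := by
  -- Invariance of `H` gives `PBP = BP`; taking adjoints gives `PBP = PB`.
  have h1 : embProj ι * B * embProj ι = B * embProj ι := by
    ext x
    simp only [mul_apply_eq_comp, embProj_apply, h _, adjoint_embedding_apply]
  have h2 := congrArg star h1
  simp only [star_mul, hB.star_eq, (isSelfAdjoint_embProj ι).star_eq, ← mul_assoc] at h2
  exact h1.symm.trans h2

/-- A self-adjoint operator in the commutant of a minimal normal extension which commutes with
the projection onto `H` and is injective on `H` is injective. -/
theorem IsMinimalNormalExtension.injective_of_commute (hN : IsMinimalNormalExtension ι S N)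
    {A : H →L[ℂ] H} {B : K →L[ℂ] K} (hB : IsSelfAdjoint B) (hBN : Commute B N)
    (hAB : Extends ι ι A B) (hA : Function.Injective A) : Function.Injective B := by
  have hBN' : Commute B (star N) := hN.normal.commute_star_right hBN
  have hBP := hAB.commute_embProj hB
  -- The complement of `ker B` reduces `N`. It contains `H`: if `B k = 0`, then `B P k = 0`, and
  -- injectivity of `A` forces `P k = 0`.
  have key : B.kerᗮ = ⊤ := by
    refine hN.minimal _ (Submodule.isClosed_orthogonal _) (fun h => ?_) (fun x hx => ?_)
      (fun x hx => ?_)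
    · rw [Submodule.mem_orthogonal]
      intro k hk
      have hk : B k = 0 := hk
      have h1 : B (embProj ι k) = 0 := by
        have := DFunLike.congr_fun hBP.eq k
        simpa [hk] using this
      rw [embProj_apply, hAB _] at h1
      have h2 : adjoint ι.toContinuousLinearMap k = 0 :=
        hA (ι.injective (by simpa using h1))
      have h3 := adjoint_inner_left ι.toContinuousLinearMap h k
      rw [h2, inner_zero_left] at h3
      exact h3.symm
    · rw [Submodule.mem_orthogonal] at hx ⊢
      intro k hk
      rw [← adjoint_inner_left]
      refine hx _ ?_
      have := DFunLike.congr_fun hBN'.eq k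
      have hk : B k = 0 := hk
      change B (star N k) = 0
      simpa [hk] using this
    · rw [Submodule.mem_orthogonal] at hx ⊢
      intro k hk
      rw [adjoint_inner_right]
      refine hx _ ?_
      have := DFunLike.congr_fun hBN.eq k
      have hk : B k = 0 := hk
      change B (N k) = 0
      simpa [hk] using this
  exact LinearMap.ker_eq_bot.1 ((Submodule.orthogonal_eq_top_iff _).1 key)

/-- If positive operators satisfy `Q² ⊆ A²` and `A` is reduced by `H`, then `Q ⊆ A`. -/
theorem extends_of_mul_self {Q : H →L[ℂ] H} {A : K →L[ℂ] K} (hQ : 0 ≤ Q) (hA : 0 ≤ A)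
    (hAP : Commute A (embProj ι)) (h : Extends ι ι (Q * Q) (A * A)) : Extends ι ι Q A := by
  have hP (x : K) : A (ι (adjoint ι.toContinuousLinearMap x)) =
      ι (adjoint ι.toContinuousLinearMap (A x)) := DFunLike.congr_fun hAP.eq x
  have hA' : 0 ≤ adjoint ι.toContinuousLinearMap ∘L A ∘L ι.toContinuousLinearMap :=
    (nonneg_iff_isPositive _).2
      (((nonneg_iff_isPositive _).1 hA).adjoint_conj ι.toContinuousLinearMap)
  have hAι (x : H) : A (ι x) = ι (adjoint ι.toContinuousLinearMap (A (ι x))) := by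
    rw [← hP, adjoint_embedding_apply]
  -- Because `H` reduces `A`, squaring commutes with compression to `H`; uniqueness of positive
  -- square roots then identifies the compression with `Q`.
  have hsq : (adjoint ι.toContinuousLinearMap ∘L A ∘L ι.toContinuousLinearMap) *
      (adjoint ι.toContinuousLinearMap ∘L A ∘L ι.toContinuousLinearMap) = Q * Q := by
    ext x
    change adjoint ι.toContinuousLinearMap (A (ι (adjoint ι.toContinuousLinearMap (A (ι x))))) =
      (Q * Q) x
    rw [← hAι]
    exact (congrArg _ (h x)).trans (adjoint_embedding_apply ι _)
  have heq := (CFC.mul_self_eq_mul_self_iff _ _ hA' hQ).1 hsq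
  intro x
  rw [hAι, ← heq]
  rfl

/-- The lift of a positive operator relative to the commutant of a minimal normal extension is
positive. -/
theorem IsLift.eq_modulus (hN : IsMinimalNormalExtension ι S N) {A : H →L[ℂ] H} {B : K →L[ℂ] K}
    (hA : 0 ≤ A) (hB : IsLift ι N A B) : B = modulus B := by
  have hBN : Commute B N := (Set.mem_centralizer_iff.1 hB.mem_commutant N rfl).symm
  have hBP : Commute B (embProj ι) :=
    (Set.mem_centralizer_iff.1 hB.mem_commutant_proj _ rfl).symm
  have hsN : Commute (star B) N := by
    have := (hN.normal.commute_star_right hBN).star_star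
    simpa using this
  have hsP : Commute (star B) (embProj ι) := by
    have := hBP.star_star
    rwa [(isSelfAdjoint_embProj ι).star_eq] at this
  have hMN : Commute (modulus B) N := commute_modulus (hsN.mul_left hBN)
  have hMP : Commute (modulus B) (embProj ι) := commute_modulus (hsP.mul_left hBP)
  -- `B*` keeps `H` invariant, so pairing with vectors of `H` suffices; there it acts as `A* = A`.
  -- Thus `B* B` extends `A²`.
  have hsA (x : H) : adjoint B (ι x) = ι (A x) := by
    have hAe : IsSelfAdjoint A := hA.isSelfAdjoint
    have h1 : embProj ι (adjoint B (ι x)) = adjoint B (ι x) := by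
      have := (DFunLike.congr_fun hsP.eq (ι x)).symm
      simpa [embProj_apply, adjoint_embedding_apply, star_eq_adjoint] using this
    rw [← h1, embProj_apply]
    congr 1
    refine ext_inner_right ℂ fun y => ?_
    rw [adjoint_inner_left, adjoint_inner_left]
    change inner ℂ (ι x) (B (ι y)) = _
    rw [hB.extends_op, ι.inner_map_map, ← adjoint_inner_left, hAe.adjoint_eq]
  have hext : Extends ι ι A (modulus B) := by
    refine extends_of_mul_self hA (modulus_nonneg B) hMP fun x => ?_
    rw [modulus_mul_self]
    change adjoint B (B (ι x)) = ι (A (A x))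
    rw [hB.extends_op, hsA]
  exact hN.eq_of_commute hBN hMN fun x => (hB.extends_op x).trans (hext x).symm

end Lift

theorem adjoint_comp_eq_zero_iff_range_isOrtho {H K L : Type*}
    [NormedAddCommGroup H] [InnerProductSpace ℂ H] [CompleteSpace H]
    [NormedAddCommGroup K] [InnerProductSpace ℂ K] [CompleteSpace K]
    [NormedAddCommGroup L] [InnerProductSpace ℂ L] [CompleteSpace L]
    {V : H →L[ℂ] K} {U : L →L[ℂ] K} :
    adjoint V ∘L U = 0 ↔ V.range ⟂ U.range := by
  rw [Submodule.isOrtho_comm, Submodule.isOrtho_iff_le, V.orthogonal_range]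
  constructor
  · rintro h _ ⟨x, rfl⟩
    exact DFunLike.congr_fun h x
  · intro h
    ext x
    exact h ⟨x, rfl⟩

end BrownianLift

/-! ### The two halves of the theorem. -/

open BrownianLift ContinuousLinearMap in
theorem theorem1p7
    {H₁ : Type u₁} [NormedAddCommGroup H₁] [InnerProductSpace ℂ H₁] [CompleteSpace H₁]
    {H₂ : Type u₂} [NormedAddCommGroup H₂] [InnerProductSpace ℂ H₂] [CompleteSpace H₂]
    {K₂ : Type u₃} [NormedAddCommGroup K₂] [InnerProductSpace ℂ K₂] [CompleteSpace K₂]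
    (V : H₁ →L[ℂ] H₁) (E : H₂ →L[ℂ] H₁) (S : H₂ →L[ℂ] H₂)
    (hT : BrownianLift.IsBrownianType BrownianLift.SubnormalClass
      (BrownianLift.blockOp V E 0 S))
    (hE : Function.Injective E)
    (ι₂ : H₂ →ₗᵢ[ℂ] K₂) (N : K₂ →L[ℂ] K₂)
    (hN : BrownianLift.IsMinimalNormalExtension ι₂ S N)
    (W : H₂ →L[ℂ] H₁)
    (hW : BrownianLift.IsPolarDecomposition E W (BrownianLift.modulus E)) :
    Function.Injective (BrownianLift.modulus E) ∧
    Isometry W ∧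
    -- part (i)
    (∀ (K₁ : Type u₄) [NormedAddCommGroup K₁] [InnerProductSpace ℂ K₁] [CompleteSpace K₁]
      (ι₁ : H₁ →ₗᵢ[ℂ] K₁) (V' : K₁ →L[ℂ] K₁) (E' U : K₂ →L[ℂ] K₁),
      BrownianLift.IsBrownianType BrownianLift.NormalClass (BrownianLift.blockOp V' E' 0 N) →
      BrownianLift.EntrywiseExtends ι₁ ι₂
        (BrownianLift.blockOp V E 0 S) (BrownianLift.blockOp V' E' 0 N) →
      BrownianLift.Extends ι₂ ι₂ (BrownianLift.modulus E) (BrownianLift.modulus E') →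
      BrownianLift.IsPolarDecomposition E' U (BrownianLift.modulus E') →
        Function.Injective E' ∧
        BrownianLift.IsLift ι₂ N (BrownianLift.modulus E) (BrownianLift.modulus E') ∧
        Isometry U ∧
        BrownianLift.Extends ι₂ ι₁ W U ∧
        LinearMap.range V'.toLinearMap ⟂ LinearMap.range U.toLinearMap) ∧
    -- part (ii)
    (∀ (K₁ : Type u₄) [NormedAddCommGroup K₁] [InnerProductSpace ℂ K₁] [CompleteSpace K₁]
      (ι₁ : H₁ →ₗᵢ[ℂ] K₁) (V' : K₁ →L[ℂ] K₁) (U : K₂ →L[ℂ] K₁) (B : K₂ →L[ℂ] K₂),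
      Isometry V' →
      Isometry U →
      BrownianLift.Extends ι₁ ι₁ V V' →
      BrownianLift.Extends ι₂ ι₁ W U →
      LinearMap.range V'.toLinearMap ⟂ LinearMap.range U.toLinearMap →
      BrownianLift.IsLift ι₂ N (BrownianLift.modulus E) B →
        BrownianLift.IsBrownianType BrownianLift.NormalClass
          (BrownianLift.blockOp V' (U ∘L B) 0 N) ∧
        BrownianLift.EntrywiseExtends ι₁ ι₂
          (BrownianLift.blockOp V E 0 S) (BrownianLift.blockOp V' (U ∘L B) 0 N) ∧
        BrownianLift.Extends ι₂ ι₂ (BrownianLift.modulus E)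
          (BrownianLift.modulus (U ∘L B)) ∧
        BrownianLift.IsPolarDecomposition (U ∘L B) U B) := by
  have hm : Function.Injective (modulus E) := (modulus_injective_iff E).2 hE
  have hWE (x : H₂) : E x = W (modulus E x) := DFunLike.congr_fun hW.factor x
  refine ⟨hm, hW.isometry hE, ?_, ?_⟩
  · intro K₁ _ _ _ ι₁ V' E' U hT' hext hmod hU
    have hc : Commute (adjoint E' ∘L E') N := by
      have := hT'.commute.symm
      rwa [entry₁₂_blockOp, entry₂₂_blockOp] at this
    have hEE (x : H₂) : E' (ι₂ x) = ι₁ (E x) := by simpa using hext.ext₁₂ x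
    have hUE (x : K₂) : E' x = U (modulus E' x) := DFunLike.congr_fun hU.factor x
    have hcN := commute_modulus hc
    have hinj : Function.Injective (modulus E') :=
      hN.injective_of_commute (isSelfAdjoint_modulus E') hcN hmod hm
    have hinj' := (modulus_injective_iff E').1 hinj
    refine ⟨hinj', ⟨?_, ?_, hmod⟩, hU.isometry hinj', ?_, ?_⟩
    · rintro _ rfl
      exact hcN.symm
    · rintro _ rfl
      exact (hmod.commute_embProj (isSelfAdjoint_modulus E')).symm
    -- Both sides are continuous and agree on the dense range of `|E|`, where they reduce to `E'`
    -- extending `E`.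
    · refine congrFun ((denseRange_of_isSelfAdjoint (isSelfAdjoint_modulus E) hm).equalizer
        (U.continuous.comp ι₂.continuous) (ι₁.continuous.comp W.continuous) (funext fun x => ?_))
      change U (ι₂ (modulus E x)) = ι₁ (W (modulus E x))
      rw [← hmod x, ← hUE, ← hWE, hEE]
    -- `V'* U` vanishes on the dense range of `|E'|`, since `V'* E' = 0`.
    · refine adjoint_comp_eq_zero_iff_range_isOrtho.1 (DFunLike.coe_injective ?_)
      refine (denseRange_of_isSelfAdjoint (isSelfAdjoint_modulus E') hinj).equalizer
        (adjoint V' ∘L U).continuous continuous_const (funext fun x => ?_)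
      have ho : adjoint V' ∘L E' = 0 := by simpa using hT'.orthogonal
      have := DFunLike.congr_fun ho x
      simpa [hUE] using this
  · intro K₁ _ _ _ ι₁ V' U B hV' hU hVV hWU hperp hB
    have hBm : B = modulus B := hB.eq_modulus hN (modulus_nonneg E)
    have hUB : modulus (U ∘L B) = B := (modulus_comp_of_isometry hU B).trans hBm.symm
    have hBsa : IsSelfAdjoint B := hBm ▸ isSelfAdjoint_modulus B
    have hBN : Commute B N := (Set.mem_centralizer_iff.1 hB.mem_commutant N rfl).symm
    -- Serves the kernel condition of the polar decomposition: `U` and `UB` both have trivial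
    -- kernel.
    have hBinj : Function.Injective B := hN.injective_of_commute hBsa hBN hB.extends_op hm
    have hort := adjoint_comp_eq_zero_iff_range_isOrtho.2 hperp
    have := hT.nontrivial₁
    have := hT.nontrivial₂
    refine ⟨⟨ι₁.injective.nontrivial, ι₂.injective.nontrivial, ?_, ?_, ?_, ?_, ?_⟩,
      ⟨?_, ?_, ?_, ?_⟩, ?_, ⟨rfl, hUB.symm, fun x _ => ?_, ?_⟩⟩
    · simp
    · simpa using hV'
    · rw [entry₁₁_blockOp, entry₁₂_blockOp, ← comp_assoc, hort, zero_comp]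
    · rw [entry₁₂_blockOp, entry₂₂_blockOp, ← modulus_mul_self, hUB]
      exact (hBN.mul_left hBN).symm
    · rw [entry₂₂_blockOp]
      exact hN.normal
    · simpa using hVV
    · intro x
      rw [entry₁₂_blockOp, entry₁₂_blockOp, hWE, ← hWU, ← hB.extends_op]
      rfl
    · intro x
      simp
    · simpa using hN.extends_op
    · rw [hUB]
      exact hB.extends_op
    · exact (AddMonoidHomClass.isometry_iff_norm U).1 hU x
    · have hUBinj : Function.Injective (U ∘L B) := hU.injective.comp hBinj
      exact (LinearMap.ker_eq_bot.2 hU.injective).trans (LinearMap.ker_eq_bot.2 hUBinj).symm
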